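/- Let $X$ be a complex Banach space with open unit ball $B$, let $x\in X$ with $\|x\|=1$, and suppose that $X$ is locally uniformly convex at $x$: whenever $(y_n)\subset X$ satisfies $\|y_n\|\to\|x\|$ and $\|x+y_n\|\to 2\|x\|$, then $\|y_n-x\|\to 0$. Let $A_\infty(B)$ be the algebra, with the supremum norm, of bounded holomorphic functions $f:B\to\mathbb{C}$ that extend continuously to the closed ball $\overline{B}$, and let $A_u(B)\subset A_\infty(B)$ be the subalgebra of uniformly continuous holomorphic functions on $B$. Let $M$ be the spectrum of $A_\infty(B)$ (the nonzero multiplicative linear functionals), let $\hat f:M\to\mathbb{C}$, $\hat f(\tau)=\tau(f)$, be the Gelfand transform of $f$, and let $P(X)$ be the space of continuous polynomials $P:X\to\mathbb{C}$. For $P\in P(X)$ let $\tilde P:X^{**}\to\mathbb{C}$ be its Aron-Berner extension, obtained by extending the symmetric multilinear forms of the homogeneous parts of $P$ to $X^{**}$ by weak-star continuity, one variable at a time, and restricting to the diagonal. For $g\in A_u(B)$ and $z\in X^{**}$ with $\|z\|\le 1$, let $\tilde g(z)=\lim_k\tilde P_k(z)$, where $(P_k)\subset P(X)$ is any sequence converging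 to $g$ uniformly on $B$. For such $z$ and for $f\in A_\infty(B)$ put $$Cl_B(f,z)=\{\lambda\in\mathbb{C}:\ \exists\text{ a net }(x_\alpha)\subset B,\ L(x_\alpha)\to z(L)\ \ \forall L\in X^*,\ f(x_\alpha)\to\lambda\},$$ $$Cl_B^{\mathcal P}(f,z)=\{\lambda\in\mathbb{C}:\ \exists\text{ a net }(x_\alpha)\subset B,\ P(x_\alpha)\to\tilde P(z)\ \ \forall P\in P(X),\ f(x_\alpha)\to\lambda\},$$ $$M_z=\{\tau\in M:\ \tau(L|_B)=z(L)\ \ \forall L\in X^*\},\qquad M_z^{\mathcal P}=\{\tau\in M:\ \tau(g)=\tilde g(z)\ \ \forall g\in A_u(B)\}.$$ Then both the polynomial and the original cluster value theorems hold for $A_\infty(B)$ at $x$ (regarded as an element of $X^{**}$), that is, $$Cl_B^{\mathcal P}(f,x)=\hat f(M_x^{\mathcal P})\quad\text{and}\quad Cl_B(f,x)=\hat f(M_x)\qquad\text{for all } f\in A_\infty(B).$$ -/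

import Mathlib

open Filter Topology Metric BoundedContinuousFunction

noncomputable section

namespace ClusterValue

variable (X : Type*) [NormedAddCommGroup X] [NormedSpace ℂ X]

/-- The open unit ball `B` of `X`, as a type. -/
abbrev UnitBall : Type _ := ball (0 : X) 1

/-- The bidual `X**`. -/
abbrev Bidual : Type _ := StrongDual ℂ (StrongDual ℂ X)

variable {X}

/-- `X` is locally uniformly convex at `x`. -/
def LocallyUniformlyConvexAt (x : X) : Prop :=
  ∀ y : ℕ → X, Tendsto (fun n => ‖y n‖) atTop (𝓝 ‖x‖) →
    Tendsto (fun n => ‖x + y n‖) atTop (𝓝 (2 * ‖x‖)) →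
    Tendsto (fun n => ‖y n - x‖) atTop (𝓝 0)

/-! ### Algebras of bounded holomorphic functions on the ball -/

/-- `f : B → ℂ` is holomorphic: around each point of `B` it is the sum of a power series
(of continuous multilinear forms). -/
def HolomorphicOnBall (f : UnitBall X → ℂ) : Prop :=
  ∃ F : X → ℂ, AnalyticOnNhd ℂ F (ball 0 1) ∧ ∀ y : UnitBall X, F y = f y

/-- `f : B → ℂ` extends continuously to the closed unit ball. -/
def ExtendsToClosedBall (f : UnitBall X → ℂ) : Prop :=
  ∃ F : X → ℂ, ContinuousOn F (closedBall 0 1) ∧ ∀ y : UnitBall X, F y = f y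

variable (X)

/-- `H^∞(B)`: the bounded holomorphic functions on `B`, with the supremum norm. -/
def HInfty : Subalgebra ℂ (UnitBall X →ᵇ ℂ) where
  carrier := {f | HolomorphicOnBall f}
  mul_mem' := by
    rintro f g ⟨F, hF, hf⟩ ⟨G, hG, hg⟩
    exact ⟨F * G, hF.mul hG, fun y => by simp [hf, hg]⟩
  add_mem' := by
    rintro f g ⟨F, hF, hf⟩ ⟨G, hG, hg⟩
    exact ⟨F + G, hF.add hG, fun y => by simp [hf, hg]⟩
  algebraMap_mem' c := ⟨fun _ => c, analyticOnNhd_const, fun _ => rfl⟩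

/-- `A_∞(B)`: the bounded holomorphic functions on `B` that extend continuously to the boundary. -/
def AInfty : Subalgebra ℂ (UnitBall X →ᵇ ℂ) where
  carrier := {f | f ∈ HInfty X ∧ ExtendsToClosedBall f}
  mul_mem' := by
    rintro f g ⟨hf', F, hF, hf⟩ ⟨hg', G, hG, hg⟩
    exact ⟨mul_mem hf' hg', F * G, hF.mul hG, fun y => by simp [hf, hg]⟩
  add_mem' := by
    rintro f g ⟨hf', F, hF, hf⟩ ⟨hg', G, hG, hg⟩
    exact ⟨add_mem hf' hg', F + G, hF.add hG, fun y => by simp [hf, hg]⟩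
  algebraMap_mem' c := ⟨(HInfty X).algebraMap_mem c, fun _ => c, continuousOn_const, fun _ => rfl⟩

/-- `A_u(B)`: the (bounded) uniformly continuous holomorphic functions on `B`. -/
def AU : Subalgebra ℂ (UnitBall X →ᵇ ℂ) where
  carrier := {f | f ∈ HInfty X ∧ UniformContinuous f}
  mul_mem' := by
    rintro f g ⟨hf', hf⟩ ⟨hg', hg⟩
    refine ⟨mul_mem hf' hg', ?_⟩
    rw [Metric.uniformContinuous_iff] at hf hg ⊢
    intro ε hε
    obtain ⟨C, hC⟩ : ∃ C : ℝ, 0 < C ∧ ‖f‖ ≤ C ∧ ‖g‖ ≤ C :=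
      ⟨‖f‖ + ‖g‖ + 1, by positivity, by linarith [norm_nonneg g], by linarith [norm_nonneg f]⟩
    obtain ⟨hC0, hCf, hCg⟩ := hC
    have hε' : 0 < ε / (2 * C) := by positivity
    obtain ⟨a, ha, hfa⟩ := hf _ hε'
    obtain ⟨b, hb, hgb⟩ := hg _ hε'
    refine ⟨min a b, lt_min ha hb, fun {u v} huv => ?_⟩
    have h1 := hfa (huv.trans_le (min_le_left _ _))
    have h2 := hgb (huv.trans_le (min_le_right _ _))
    rw [dist_eq_norm] at h1 h2 ⊢
    have e : (f * g) u - (f * g) v = f u * (g u - g v) + (f u - f v) * g v := by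
      simp only [BoundedContinuousFunction.mul_apply]; ring
    rw [e]
    have h3 : ‖f u * (g u - g v)‖ ≤ C * ‖g u - g v‖ := by
      rw [norm_mul]; gcongr; exact (f.norm_coe_le_norm u).trans hCf
    have h4 : ‖(f u - f v) * g v‖ ≤ ‖f u - f v‖ * C := by
      rw [norm_mul]; gcongr; exact (g.norm_coe_le_norm v).trans hCg
    calc _ ≤ C * ‖g u - g v‖ + ‖f u - f v‖ * C := (norm_add_le _ _).trans (add_le_add h3 h4)
      _ < C * (ε / (2 * C)) + ε / (2 * C) * C := by gcongr
      _ = ε := by field_simp; ring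
  add_mem' := by
    rintro f g ⟨hf', hf⟩ ⟨hg', hg⟩
    exact ⟨add_mem hf' hg', hf.add hg⟩
  algebraMap_mem' c := ⟨(HInfty X).algebraMap_mem c, uniformContinuous_const⟩

theorem AU_le_AInfty : AU X ≤ AInfty X := by
  rintro f ⟨hf', hf⟩
  refine ⟨hf', ?_⟩
  classical
  have hle : ball (0 : X) 1 ⊆ closedBall 0 1 := ball_subset_closedBall
  let i : UnitBall X → closedBall (0 : X) 1 := Set.inclusion hle
  have hi : IsUniformInducing i := (isUniformEmbedding_set_inclusion hle).isUniformInducing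
  have hd : DenseRange i := by
    intro p
    rw [closure_subtype, ← Set.range_comp]
    have hr : Set.range ((Subtype.val : closedBall (0 : X) 1 → X) ∘ i) = ball 0 1 := by
      ext y
      exact ⟨fun ⟨q, hq⟩ => hq ▸ q.2, fun hy => ⟨⟨y, hy⟩, rfl⟩⟩
    rw [hr, closure_ball (0 : X) one_ne_zero]
    exact p.2
  let G := (hi.isDenseInducing hd).extend f
  have hG : Continuous G := (uniformContinuous_uniformly_extend hi hd hf).continuous
  refine ⟨fun x => if h : x ∈ closedBall (0 : X) 1 then G ⟨x, h⟩ else 0, ?_, ?_⟩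
  · rw [continuousOn_iff_continuous_domRestrict]
    convert hG using 1
    ext p
    exact dif_pos p.2
  · intro y
    refine (dif_pos (hle y.2)).trans ?_
    exact uniformly_extend_of_ind hi hd hf y

variable {X}

/-- The restriction to `B` of a continuous linear functional, as an element of `A_u(B)`. -/
def dualRestrict (L : StrongDual ℂ X) : AU X :=
  ⟨BoundedContinuousFunction.ofNormedAddCommGroup (fun y : UnitBall X => L y)
      (by fun_prop) ‖L‖ (fun y => by
        have hy : ‖(y : X)‖ ≤ 1 := (mem_ball_zero_iff.1 y.2).le
        simpa using L.le_of_opNorm_le_of_le le_rfl hy),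
    ⟨fun x => L x, L.analyticOnNhd _, fun _ => rfl⟩,
    L.uniformContinuous.comp uniformContinuous_subtype_val⟩

/-! ### The cluster value theorem -/

/-- The cluster set of `f` at `z ∈ X**`: the limits of `f` along the filters (equivalently, nets)
on `B` that converge to `z` in the weak-star topology. -/
def clusterSet (f : UnitBall X → ℂ) (z : Bidual X) : Set ℂ :=
  {w | ∃ l : Filter (UnitBall X), l.NeBot ∧
    (∀ L : StrongDual ℂ X, Tendsto (fun y : UnitBall X => L y) l (𝓝 (z L))) ∧
    Tendsto f l (𝓝 w)}

/-- The fiber over `z ∈ X**` of the spectrum of an algebra `H ⊇ A_u(B)`: the characters whose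
restriction to `X*` is `z`. -/
def fiber (H : Subalgebra ℂ (UnitBall X →ᵇ ℂ)) (hH : AU X ≤ H) (z : Bidual X) :
    Set (WeakDual.characterSpace ℂ H) :=
  {φ | ∀ L : StrongDual ℂ X, φ (Subalgebra.inclusion hH (dualRestrict L)) = z L}

/-- The cluster value theorem holds for `H` at `z`. -/
def ClusterValueTheoremAt (H : Subalgebra ℂ (UnitBall X →ᵇ ℂ)) (hH : AU X ≤ H)
    (z : Bidual X) : Prop :=
  ∀ f : H, clusterSet (f : UnitBall X →ᵇ ℂ) z =
    WeakDual.gelfandTransform ℂ H f '' fiber H hH z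

/-! ### Continuous polynomials and their Aron-Berner extensions -/

/-- The Arens extension to `X**` of continuous `n`-linear forms on `X`, obtained by extending by
weak-star continuity one variable at a time: `arens z A` is `z₀` applied to the functional
`x₀ ↦ arens (z₁, …) (A (x₀, ·))`. -/
def arens : (n : ℕ) → (Fin n → Bidual X) →
    (ContinuousMultilinearMap ℂ (fun _ : Fin n => X) ℂ →L[ℂ] ℂ)
  | 0, _ => ContinuousMultilinearMap.apply ℂ (fun _ : Fin 0 => X) ℂ 0
  | n + 1, z =>
      (z 0).comp
        ((ContinuousLinearMap.compL ℂ X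
            (ContinuousMultilinearMap ℂ (fun _ : Fin n => X) ℂ) ℂ (arens n (Fin.tail z))).comp
          (continuousMultilinearCurryLeftEquiv ℂ (fun _ : Fin (n + 1) => X) ℂ :
            ContinuousMultilinearMap ℂ (fun _ : Fin (n + 1) => X) ℂ →L[ℂ]
              X →L[ℂ] ContinuousMultilinearMap ℂ (fun _ : Fin n => X) ℂ))

variable (X)

/-- A continuous polynomial `P(x) = ∑_{n ≤ N} Aₙ(x, …, x)` on `X`, given through the symmetric
continuous `n`-linear forms `Aₙ` of its homogeneous parts. -/
structure ContPolynomial where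
  /-- a bound for the degree -/
  degree : ℕ
  /-- the symmetric multilinear forms -/
  form : (n : ℕ) → ContinuousMultilinearMap ℂ (fun _ : Fin n => X) ℂ
  symm : ∀ (n : ℕ) (σ : Equiv.Perm (Fin n)) (v : Fin n → X),
    form n (fun i => v (σ i)) = form n v

variable {X}

/-- The value `P(x)`. -/
def ContPolynomial.eval (P : ContPolynomial X) (x : X) : ℂ :=
  ∑ n ∈ Finset.range (P.degree + 1), P.form n (fun _ => x)

/-- The Aron-Berner extension of `P`, evaluated at `z ∈ X**`. -/
def ContPolynomial.aronBerner (P : ContPolynomial X) (z : Bidual X) : ℂ :=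
  ∑ n ∈ Finset.range (P.degree + 1), arens n (fun _ => z) (P.form n)

/-- `w` is the value at `z` (in the closed unit ball of `X**`) of the Aron-Berner extension of
`g ∈ A_u(B)`: there are continuous polynomials converging to `g` uniformly on `B`, whose
Aron-Berner extensions converge to `w` at `z`. -/
def IsAronBernerValue (g : UnitBall X → ℂ) (z : Bidual X) (w : ℂ) : Prop :=
  ∃ P : ℕ → ContPolynomial X,
    TendstoUniformly (fun k (y : UnitBall X) => (P k).eval y) g atTop ∧
    Tendsto (fun k => (P k).aronBerner z) atTop (𝓝 w)

/-! ### The polynomial cluster value theorem -/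

/-- The polynomial cluster set of `f` at `z ∈ X**`: the limits of `f` along the filters
(equivalently, nets) on `B` that converge to `z` in the polynomial-star topology. -/
def polyClusterSet (f : UnitBall X → ℂ) (z : Bidual X) : Set ℂ :=
  {w | ∃ l : Filter (UnitBall X), l.NeBot ∧
    (∀ P : ContPolynomial X,
      Tendsto (fun y : UnitBall X => P.eval y) l (𝓝 (P.aronBerner z))) ∧
    Tendsto f l (𝓝 w)}

/-- The polynomial fiber over `z` of the spectrum of `H ⊇ A_u(B)`: the characters whose
restriction to `A_u(B)` is evaluation of the Aron-Berner extension at `z`. -/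
def polyFiber (H : Subalgebra ℂ (UnitBall X →ᵇ ℂ)) (hH : AU X ≤ H) (z : Bidual X) :
    Set (WeakDual.characterSpace ℂ H) :=
  {φ | ∀ g : AU X,
    IsAronBernerValue (g : UnitBall X →ᵇ ℂ) z (φ (Subalgebra.inclusion hH g))}

/-- The polynomial cluster value theorem holds for `H` at `z`. -/
def PolyClusterValueTheoremAt (H : Subalgebra ℂ (UnitBall X →ᵇ ℂ)) (hH : AU X ≤ H)
    (z : Bidual X) : Prop :=
  ∀ f : H, polyClusterSet (f : UnitBall X →ᵇ ℂ) z =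
    WeakDual.gelfandTransform ℂ H f '' polyFiber H hH z

end ClusterValue

end

/-!
Let `x` be a point of the unit sphere at which `X` is locally uniformly convex, and let `L` be a
functional with `‖L‖ ≤ 1` and `L x = 1`. If `L y` is close to `1` for some `y` in the ball, then
`‖y‖` is close to `1` and `‖x + y‖ ≥ ‖L (x + y)‖` is close to `2`, so `y` is close to `x` in norm:
`L` strongly exposes `x`. Both sides of both cluster value equalities are then the single point
`f(x)`, the boundary value of `f ∈ A_∞(B)` at `x`.

* Cluster sets: a net of the ball that converges weakly to `x` satisfies `L y → 1`, so it converges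
  in norm, and `f` converges to `f(x)` along it (`clusterSet_eq_singleton`). Polynomial-star
  convergence lies between the weak and the norm one.
* Fibers: `g = (1 + L) / 2` is a peak function for `x`. It has modulus at most `1` on `B`, and
  bounded away from `1` off every neighbourhood of `x`; hence `(f - f(x)) gⁿ → 0` in norm. A
  character `φ` in the fiber over `x` has `φ g = 1`, so `φ (f - f(x)) = φ ((f - f(x)) gⁿ) → 0`, and
  `φ` is evaluation at `x` (`fiber_eq_singleton`).
* Polynomial fiber: at a point of `X` the Aron-Berner extension of a polynomial is the polynomial
  itself, so that of `g ∈ A_u(B)` is the continuous extension of `g`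
  (`isAronBernerValue_inclusionInDoubleDual_iff`). That evaluation at `x` lies in the polynomial
  fiber rests on the density of the polynomials in `A_u(B)` (`exists_polynomial_near`), which comes
  from Cauchy's estimates for the Taylor polynomials of the dilations `y ↦ g (r y)`.
-/

namespace ClusterValue

variable {X : Type*} [NormedAddCommGroup X] [NormedSpace ℂ X]

/-! ### Taylor polynomials of holomorphic functions on the ball -/

/-- The derivatives at `0` of the slice `ζ ↦ F (ζ y)` are the diagonal values of the
derivatives of `F`. -/
theorem iteratedDeriv_slice {F : X → ℂ} (hF : AnalyticOnNhd ℂ F (ball 0 1)) (y : X) (n : ℕ) :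
    iteratedDeriv n (fun ζ : ℂ => F (ζ • y)) 0 = iteratedFDeriv ℂ n F 0 (fun _ => y) := by
  let g : ℂ →L[ℂ] X := ContinuousLinearMap.toSpanSingleton ℂ y
  have ho : IsOpen (g ⁻¹' ball 0 1) := isOpen_ball.preimage g.continuous
  have h0 : g 0 ∈ ball (0 : X) 1 := by simp
  have hd : ContDiffOn ℂ n F (ball 0 1) := fun z hz => (hF z hz).contDiffAt.contDiffWithinAt
  have h := g.iteratedFDerivWithin_comp_right hd isOpen_ball.uniqueDiffOn ho.uniqueDiffOn h0 le_rfl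
  rw [iteratedFDerivWithin_of_isOpen n ho h0, iteratedFDerivWithin_of_isOpen n isOpen_ball h0] at h
  rw [iteratedDeriv_eq_iteratedFDeriv]
  have e : (fun ζ : ℂ => F (ζ • y)) = F ∘ g := rfl
  rw [e, h]
  simp [g]

/-- The degree `N` Taylor polynomial at `0` of the dilation `y ↦ F (r y)`. -/
noncomputable def taylorPolynomial {F : X → ℂ} (hF : AnalyticAt ℂ F 0) (r : ℂ) (N : ℕ) :
    ContPolynomial X where
  degree := N
  form n := ((n.factorial : ℂ)⁻¹ * r ^ n) • iteratedFDeriv ℂ n F 0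
  symm n σ v := by
    have h := hF.contDiffAt.iteratedFDeriv_comp_perm v σ
    rw [Function.comp_def] at h
    simp [h]

/-- Cauchy's estimates on the complex lines through `0` bound the error of the Taylor polynomials
of a dilation of `F`, uniformly on the ball. -/
theorem norm_taylorPolynomial_eval_sub_le {F : X → ℂ} (hF : AnalyticOnNhd ℂ F (ball 0 1)) {C : ℝ}
    (hC : ∀ y ∈ ball (0 : X) 1, ‖F y‖ ≤ C) {r : ℝ} (hr0 : 0 ≤ r) (hr1 : r < 1) (N : ℕ) {y : X}
    (hy : y ∈ ball (0 : X) 1) :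
    ‖(taylorPolynomial (hF 0 (mem_ball_self one_pos)) r N).eval y - F ((r : ℂ) • y)‖ ≤
      C * r ^ (N + 1) / (1 - r) := by
  set φ : ℂ → ℂ := fun ζ => F (ζ • y) with hφ
  have hsub : ∀ ζ ∈ closedBall (0 : ℂ) 1, ζ • y ∈ ball (0 : X) 1 := by
    intro ζ hζ
    rw [mem_closedBall_zero_iff] at hζ
    rw [mem_ball_zero_iff] at hy ⊢
    rw [norm_smul]
    nlinarith [norm_nonneg y, norm_nonneg ζ]
  have hd : DifferentiableOn ℂ φ (closedBall 0 1) := fun ζ hζ => by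
    have h1 : DifferentiableAt ℂ F (ζ • y) := (hF _ (hsub ζ hζ)).differentiableAt
    have h2 : DifferentiableAt ℂ (fun ζ : ℂ => ζ • y) ζ := by fun_prop
    exact (h1.comp ζ h2).differentiableWithinAt
  have hr : ((r : ℝ) : ℂ) ∈ ball (0 : ℂ) 1 := by
    simpa [abs_of_nonneg hr0] using hr1
  have hs := Complex.hasSum_taylorSeries_on_ball (hd.mono ball_subset_closedBall) hr
  have hb : ∀ n : ℕ,
      ‖(n.factorial : ℂ)⁻¹ • ((r : ℂ) - 0) ^ n • iteratedDeriv n φ 0‖ ≤ C * r ^ n := by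
    intro n
    have h := Complex.norm_iteratedDeriv_le_of_forall_mem_sphere_norm_le n one_pos
      (hd.diffContOnCl_ball subset_rfl) (C := C)
      (fun ζ hζ => hC _ (hsub ζ (sphere_subset_closedBall hζ)))
    have hn : (0 : ℝ) < n.factorial := by positivity
    rw [one_pow, div_one] at h
    rw [norm_smul, norm_smul, sub_zero, norm_pow, norm_inv, Complex.norm_natCast,
      Complex.norm_real, Real.norm_of_nonneg hr0]
    calc _ ≤ (n.factorial : ℝ)⁻¹ * (r ^ n * (n.factorial * C)) := by gcongr
      _ = C * r ^ n := by field_simp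
  have he : (taylorPolynomial (hF 0 (mem_ball_self one_pos)) r N).eval y =
      ∑ n ∈ Finset.range (N + 1), (n.factorial : ℂ)⁻¹ • ((r : ℂ) - 0) ^ n • iteratedDeriv n φ 0 := by
    refine Finset.sum_congr rfl fun n _ => ?_
    rw [hφ, iteratedDeriv_slice hF y n]
    simp [taylorPolynomial, mul_assoc]
  rw [he]
  exact norm_sub_le_of_geometric_bound_of_hasSum hr1 hb hs (N + 1)

/-- Continuous polynomials are uniformly dense in `A_u(B)`: by uniform continuity `g` is close to
a dilation `y ↦ g (r y)`, and that is close to one of its Taylor polynomials. -/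
theorem exists_polynomial_near (g : AU X) {ε : ℝ} (hε : 0 < ε) :
    ∃ P : ContPolynomial X, ∀ y : UnitBall X, ‖P.eval y - (g : UnitBall X →ᵇ ℂ) y‖ < ε := by
  obtain ⟨g, ⟨F, hF, hFg⟩, hu⟩ := g
  obtain ⟨δ, hδ, hu⟩ := Metric.uniformContinuous_iff.1 hu (ε / 2) (half_pos hε)
  obtain ⟨r, hr0, hr1⟩ : ∃ r : ℝ, max 0 (1 - δ) < r ∧ r < 1 := exists_between (by simp [hδ])
  rw [max_lt_iff] at hr0
  have hC : ∀ y ∈ ball (0 : X) 1, ‖F y‖ ≤ ‖g‖ := fun y hy => by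
    rw [hFg ⟨y, hy⟩]
    exact g.norm_coe_le_norm _
  have hlim : Tendsto (fun N : ℕ => ‖g‖ * r ^ (N + 1) / (1 - r)) atTop (𝓝 0) := by
    have h := (tendsto_pow_atTop_nhds_zero_of_lt_one hr0.1.le hr1).comp (tendsto_add_atTop_nat 1)
    simpa using (h.const_mul ‖g‖).div_const (1 - r)
  obtain ⟨N, hN⟩ := (hlim.eventually (gt_mem_nhds (half_pos hε))).exists
  refine ⟨taylorPolynomial (hF 0 (mem_ball_self one_pos)) r N, fun y => ?_⟩
  have hy1 : ‖(y : X)‖ < 1 := mem_ball_zero_iff.1 y.2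
  have hry : (r : ℂ) • (y : X) ∈ ball (0 : X) 1 := by
    rw [mem_ball_zero_iff, norm_smul, Complex.norm_real, Real.norm_of_nonneg hr0.1.le]
    nlinarith [norm_nonneg (y : X)]
  have h1 := norm_taylorPolynomial_eval_sub_le hF hC hr0.1.le hr1 N y.2
  have hdist : dist (⟨(r : ℂ) • (y : X), hry⟩ : UnitBall X) y < δ := by
    rw [Subtype.dist_eq, dist_eq_norm]
    have e : (r : ℂ) • (y : X) - y = ((r - 1 : ℝ) : ℂ) • (y : X) := by
      push_cast; rw [sub_smul, one_smul]
    rw [e, norm_smul, Complex.norm_real, Real.norm_of_nonpos (by linarith)]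
    nlinarith [norm_nonneg (y : X)]
  have h2 := hu hdist
  rw [dist_eq_norm, ← hFg] at h2
  calc _ ≤ _ := norm_sub_le_norm_sub_add_norm_sub _ (F ((r : ℂ) • (y : X))) _
    _ < ε / 2 + ε / 2 := add_lt_add (h1.trans_lt hN) h2
    _ = ε := add_halves ε

/-! ### Aron-Berner extensions at points of `X` -/

theorem arens_inclusionInDoubleDual (x : X) (n : ℕ)
    (A : ContinuousMultilinearMap ℂ (fun _ : Fin n => X) ℂ) :
    arens n (fun _ => NormedSpace.inclusionInDoubleDual ℂ X x) A = A (fun _ => x) := by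
  induction n with
  | zero =>
    simp only [arens, ContinuousMultilinearMap.apply_apply]
    exact congrArg A (Subsingleton.elim _ _)
  | succ n ih =>
    have h := ih (A.curryLeft x)
    simp only [arens, ContinuousLinearMap.comp_apply, NormedSpace.dual_def]
    refine h.trans ?_
    rw [ContinuousMultilinearMap.curryLeft_apply]
    exact congrArg A (funext fun i => Fin.cases rfl (fun _ => rfl) i)

theorem ContPolynomial.aronBerner_inclusionInDoubleDual (P : ContPolynomial X) (x : X) :
    P.aronBerner (NormedSpace.inclusionInDoubleDual ℂ X x) = P.eval x :=
  Finset.sum_congr rfl fun _ _ => arens_inclusionInDoubleDual x _ _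

theorem ContPolynomial.continuous_eval (P : ContPolynomial X) : Continuous P.eval :=
  continuous_finsetSum _ fun n _ => (P.form n).cont.comp (continuous_pi fun _ => continuous_id)

/-- A continuous linear functional, as a polynomial of degree one. -/
noncomputable def linearPolynomial (L : StrongDual ℂ X) : ContPolynomial X where
  degree := 1
  form
    | 1 => ContinuousMultilinearMap.ofSubsingleton ℂ X ℂ (0 : Fin 1) L
    | _ => 0
  symm n σ v := by
    match n with
    | 0 => rfl
    | 1 => rw [Subsingleton.elim σ 1]; rfl
    | _ + 2 => rfl

theorem linearPolynomial_eval (L : StrongDual ℂ X) (y : X) : (linearPolynomial L).eval y = L y := by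
  simp [ContPolynomial.eval, linearPolynomial, Finset.sum_range_succ]

/-! ### Boundary values -/

/-- The trace on `B` of the norm neighbourhoods of a point of `X`. -/
noncomputable def nhdsInBall (x : X) : Filter (UnitBall X) := comap Subtype.val (𝓝 x)

theorem nhdsInBall_neBot {x : X} (hx : ‖x‖ ≤ 1) : (nhdsInBall x).NeBot := by
  have h : x ∈ closure (ball (0 : X) 1) := by
    rw [closure_ball (0 : X) one_ne_zero]
    simpa using hx
  exact mem_closure_iff_comap_neBot.1 h

omit [NormedSpace ℂ X] in
theorem tendsto_nhdsInBall (x : X) :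
    Tendsto (Subtype.val : UnitBall X → X) (nhdsInBall x) (𝓝 x) := tendsto_comap

/-- The value at `x` of the continuous extension of `f` to the closed ball, as a limit from inside
the ball. It is meaningful only for `‖x‖ ≤ 1`. -/
noncomputable def boundaryValue (x : X) (f : AInfty X) : ℂ :=
  limUnder (nhdsInBall x) (f : UnitBall X →ᵇ ℂ)

theorem tendsto_boundaryValue {x : X} (hx : ‖x‖ ≤ 1) (f : AInfty X) :
    Tendsto (f : UnitBall X →ᵇ ℂ) (nhdsInBall x) (𝓝 (boundaryValue x f)) := by
  obtain ⟨F, hF, hFf⟩ := f.2.2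
  refine tendsto_nhds_limUnder ⟨F x, ?_⟩
  have h1 : Tendsto F (𝓝[closedBall 0 1] x) (𝓝 (F x)) := hF x (by simpa using hx)
  have h2 : Tendsto (Subtype.val : UnitBall X → X) (nhdsInBall x) (𝓝[closedBall 0 1] x) :=
    tendsto_nhdsWithin_iff.2
      ⟨tendsto_nhdsInBall x, Eventually.of_forall fun y => ball_subset_closedBall y.2⟩
  exact (h1.comp h2).congr hFf

theorem boundaryValue_eq {x : X} (hx : ‖x‖ ≤ 1) {f : AInfty X} {w : ℂ}
    (h : Tendsto (f : UnitBall X →ᵇ ℂ) (nhdsInBall x) (𝓝 w)) : boundaryValue x f = w :=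
  haveI := nhdsInBall_neBot hx
  tendsto_nhds_unique (tendsto_boundaryValue hx f) h

theorem norm_boundaryValue_le {x : X} (hx : ‖x‖ ≤ 1) (f : AInfty X) :
    ‖boundaryValue x f‖ ≤ ‖f‖ :=
  haveI := nhdsInBall_neBot hx
  le_of_tendsto (tendsto_boundaryValue hx f).norm
    (Eventually.of_forall fun y => (f : UnitBall X →ᵇ ℂ).norm_coe_le_norm y)

/-- Evaluation at a point of the closed ball, as a character of `A_∞(B)`. -/
noncomputable def evalCharacter (x : X) (hx : ‖x‖ ≤ 1) : WeakDual.characterSpace ℂ (AInfty X) :=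
  ⟨StrongDual.toWeakDual (LinearMap.mkContinuous
    { toFun := boundaryValue x
      map_add' := fun f g => boundaryValue_eq hx
        ((tendsto_boundaryValue hx f).add (tendsto_boundaryValue hx g))
      map_smul' := fun c f => boundaryValue_eq hx ((tendsto_boundaryValue hx f).const_smul c) }
    1 (fun f => (norm_boundaryValue_le hx f).trans_eq (one_mul _).symm)), by
    rw [WeakDual.CharacterSpace.eq_set_map_one_map_mul]
    exact ⟨boundaryValue_eq hx tendsto_const_nhds, fun f g => boundaryValue_eq hx
      ((tendsto_boundaryValue hx f).mul (tendsto_boundaryValue hx g))⟩⟩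

@[simp]
theorem evalCharacter_apply {x : X} (hx : ‖x‖ ≤ 1) (f : AInfty X) :
    evalCharacter x hx f = boundaryValue x f := rfl

theorem boundaryValue_dualRestrict {x : X} (hx : ‖x‖ ≤ 1) (L : StrongDual ℂ X) :
    boundaryValue x (Subalgebra.inclusion (AU_le_AInfty X) (dualRestrict L)) = L x :=
  boundaryValue_eq hx ((L.continuous.tendsto x).comp (tendsto_nhdsInBall x))

/-- At points of the closed ball of `X` the Aron-Berner extension of `g ∈ A_u(B)` is the
continuous extension of `g`. -/
theorem isAronBernerValue_inclusionInDoubleDual_iff {x : X} (hx : ‖x‖ ≤ 1) (g : AU X) (w : ℂ) :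
    IsAronBernerValue (g : UnitBall X →ᵇ ℂ) (NormedSpace.inclusionInDoubleDual ℂ X x) w ↔
      w = boundaryValue x (Subalgebra.inclusion (AU_le_AInfty X) g) := by
  have := nhdsInBall_neBot hx
  have hg := tendsto_boundaryValue hx (Subalgebra.inclusion (AU_le_AInfty X) g)
  have key : ∀ P : ℕ → ContPolynomial X,
      TendstoUniformly (fun k (y : UnitBall X) => (P k).eval y) (g : UnitBall X →ᵇ ℂ) atTop →
      Tendsto (fun k => (P k).aronBerner (NormedSpace.inclusionInDoubleDual ℂ X x)) atTop
        (𝓝 (boundaryValue x (Subalgebra.inclusion (AU_le_AInfty X) g))) := by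
    intro P hP
    simp only [ContPolynomial.aronBerner_inclusionInDoubleDual]
    rw [Metric.tendsto_atTop]
    intro ε hε
    obtain ⟨K, hK⟩ := eventually_atTop.1 (Metric.tendstoUniformly_iff.1 hP (ε / 2) (half_pos hε))
    refine ⟨K, fun k hk => ?_⟩
    have h1 : Tendsto (fun y : UnitBall X => dist ((P k).eval y) ((g : UnitBall X →ᵇ ℂ) y))
        (nhdsInBall x) (𝓝 (dist ((P k).eval x)
          (boundaryValue x (Subalgebra.inclusion (AU_le_AInfty X) g)))) :=
      (((P k).continuous_eval.tendsto x).comp (tendsto_nhdsInBall x)).dist hg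
    refine (le_of_tendsto h1 (Eventually.of_forall fun y => ?_)).trans_lt (half_lt_self hε)
    rw [dist_comm]
    exact (hK k hk y).le
  constructor
  · rintro ⟨P, hP, hw⟩
    exact tendsto_nhds_unique hw (key P hP)
  · rintro rfl
    choose P hP using fun k : ℕ =>
      exists_polynomial_near g (Nat.one_div_pos_of_nat (n := k) (α := ℝ))
    have hu : TendstoUniformly (fun k (y : UnitBall X) => (P k).eval y) (g : UnitBall X →ᵇ ℂ)
        atTop := by
      rw [Metric.tendstoUniformly_iff]
      intro ε hε
      obtain ⟨K, hK⟩ := exists_nat_one_div_lt hε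
      filter_upwards [eventually_ge_atTop K] with k hk y
      rw [dist_comm, dist_eq_norm]
      exact (hP k y).trans ((Nat.one_div_le_one_div hk).trans_lt hK)
    exact ⟨P, hu, key P hu⟩

/-! ### Locally uniformly convex points are strongly exposed -/

/-- If `L` norms `x`, then `L` strongly exposes `x`: points of the ball at which `L` is close to
`1` are close to `x`. -/
theorem exists_norm_sub_lt_of_norm_sub_one_lt {x : X} (hx : ‖x‖ = 1)
    (hconv : LocallyUniformlyConvexAt x) {L : StrongDual ℂ X} (hL : ‖L‖ ≤ 1) (hLx : L x = 1)
    {ε : ℝ} (hε : 0 < ε) :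
    ∃ δ > 0, ∀ y : UnitBall X, ‖L y - 1‖ < δ → ‖(y : X) - x‖ < ε := by
  by_contra! h
  choose y hy hyε using fun n : ℕ => h (1 / ((n : ℝ) + 1)) Nat.one_div_pos_of_nat
  have hLy : Tendsto (fun n => L (y n : X)) atTop (𝓝 1) := by
    rw [tendsto_iff_norm_sub_tendsto_zero]
    exact squeeze_zero (fun _ => norm_nonneg _) (fun n => (hy n).le)
      tendsto_one_div_add_atTop_nhds_zero_nat
  have hle : ∀ z : X, ‖L z‖ ≤ ‖z‖ := fun z => by simpa using L.le_of_opNorm_le hL z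
  have hy1 : ∀ n, ‖(y n : X)‖ ≤ 1 := fun n => (mem_ball_zero_iff.1 (y n).2).le
  have h1 : Tendsto (fun n => ‖(y n : X)‖) atTop (𝓝 ‖x‖) := by
    rw [hx]
    have h := hLy.norm
    rw [norm_one] at h
    exact tendsto_of_tendsto_of_tendsto_of_le_of_le h tendsto_const_nhds (fun n => hle _) hy1
  have h2 : Tendsto (fun n => ‖x + (y n : X)‖) atTop (𝓝 (2 * ‖x‖)) := by
    have h := (hLy.const_add (L x)).norm
    rw [hLx, show ‖(1 : ℂ) + 1‖ = 2 * ‖x‖ by rw [hx]; norm_num] at h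
    refine tendsto_of_tendsto_of_tendsto_of_le_of_le h tendsto_const_nhds (fun n => ?_) fun n => ?_
    · simpa [hLx] using hle (x + y n)
    · have := norm_add_le x (y n)
      have := hy1 n
      simp only
      linarith
  obtain ⟨n, hn⟩ := ((hconv _ h1 h2).eventually (gt_mem_nhds hε)).exists
  exact (hyε n).not_gt hn

/-- Weak convergence in the ball to a locally uniformly convex point of the sphere is norm
convergence. -/
theorem le_nhdsInBall_of_tendsto {x : X} (hx : ‖x‖ = 1) (hconv : LocallyUniformlyConvexAt x)
    {l : Filter (UnitBall X)}
    (hl : ∀ L : StrongDual ℂ X, Tendsto (fun y : UnitBall X => L y) l (𝓝 (L x))) :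
    l ≤ nhdsInBall x := by
  obtain ⟨L, hL, hLx⟩ := exists_dual_vector'' ℂ x
  rw [hx] at hLx
  rw [nhdsInBall, ← tendsto_iff_comap, tendsto_iff_norm_sub_tendsto_zero]
  have h : Tendsto (fun y : UnitBall X => ‖L y - 1‖) l (𝓝 0) := by
    rw [← tendsto_iff_norm_sub_tendsto_zero]
    simpa [hLx] using hl L
  refine Metric.tendsto_nhds.2 fun ε hε => ?_
  obtain ⟨δ, hδ, hd⟩ := exists_norm_sub_lt_of_norm_sub_one_lt hx hconv hL (by simpa using hLx) hε
  filter_upwards [h.eventually (gt_mem_nhds hδ)] with y hy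
  simpa using hd y hy

/-! ### The fiber is a point -/

/-- By the parallelogram identity, `(1 + w) / 2` has modulus less than `1` away from `w = 1`. -/
theorem norm_half_one_add_le {w : ℂ} (hw : ‖w‖ ≤ 1) {δ : ℝ} (hδ : 0 ≤ δ) (h : δ ≤ ‖w - 1‖) :
    ‖(2 : ℂ)⁻¹ * (1 + w)‖ ≤ √(1 - δ ^ 2 / 4) := by
  apply Real.le_sqrt_of_sq_le
  have h1 := parallelogram_law_with_norm ℂ w 1
  rw [norm_mul, norm_inv, add_comm 1 w]
  simp only [norm_one, Complex.norm_ofNat] at h1 ⊢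
  nlinarith [norm_nonneg w]

/-- The powers of the peak function `(1 + L) / 2` annihilate in the limit every function that
vanishes at the strongly exposed point `x`. -/
theorem tendsto_mul_peak_pow {x : X} (hx : ‖x‖ = 1) (hconv : LocallyUniformlyConvexAt x)
    {L : StrongDual ℂ X} (hL : ‖L‖ ≤ 1) (hLx : L x = 1) {h g : AInfty X}
    (hg : ∀ y : UnitBall X, (g : UnitBall X →ᵇ ℂ) y = (2 : ℂ)⁻¹ * (1 + L y))
    (h0 : boundaryValue x h = 0) : Tendsto (fun n : ℕ => h * g ^ n) atTop (𝓝 0) := by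
  have hlim := tendsto_boundaryValue hx.le h
  rw [h0] at hlim
  have hLy : ∀ y : UnitBall X, ‖L y‖ ≤ 1 := fun y => by
    have h1 : ‖(y : X)‖ < 1 := mem_ball_zero_iff.1 y.2
    have h2 : ‖L y‖ ≤ 1 * ‖(y : X)‖ := L.le_of_opNorm_le hL y
    linarith
  rw [Metric.tendsto_atTop]
  intro ε hε
  have hev := hlim.norm.eventually (gt_mem_nhds (by simpa using half_pos hε : ‖(0 : ℂ)‖ < ε / 2))
  obtain ⟨η, hη, hη'⟩ := (Metric.nhds_basis_ball.comap _).eventually_iff.1 hev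
  obtain ⟨δ, hδ, hd⟩ := exists_norm_sub_lt_of_norm_sub_one_lt hx hconv hL hLx hη
  set q := √(1 - δ ^ 2 / 4)
  have hq0 : 0 ≤ q := Real.sqrt_nonneg _
  have hq1 : q < 1 := by
    rw [Real.sqrt_lt' one_pos]
    nlinarith
  have hpow : Tendsto (fun n : ℕ => ‖h‖ * q ^ n) atTop (𝓝 0) := by
    have h1 := (tendsto_pow_atTop_nhds_zero_of_lt_one hq0 hq1).const_mul ‖h‖
    rwa [mul_zero] at h1
  obtain ⟨N, hN⟩ := eventually_atTop.1 (hpow.eventually (gt_mem_nhds (half_pos hε)))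
  refine ⟨N, fun n hn => ?_⟩
  rw [dist_zero_right]
  refine lt_of_le_of_lt ?_ (half_lt_self hε)
  change ‖((h * g ^ n : AInfty X) : UnitBall X →ᵇ ℂ)‖ ≤ ε / 2
  refine (BoundedContinuousFunction.norm_le (half_pos hε).le).2 fun y => ?_
  have e : ((h * g ^ n : AInfty X) : UnitBall X →ᵇ ℂ) y =
      (h : UnitBall X →ᵇ ℂ) y * ((2 : ℂ)⁻¹ * (1 + L y)) ^ n := by
    rw [← hg, ← BoundedContinuousFunction.pow_apply]
    rfl
  rw [e, norm_mul, norm_pow]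
  -- Near `x` the factor `h` is small; away from `x` the power of the peak function is.
  rcases lt_or_ge ‖L y - 1‖ δ with hy | hy
  · have h1 : ‖(h : UnitBall X →ᵇ ℂ) y‖ < ε / 2 := hη' (by simpa [dist_eq_norm] using hd y hy)
    have h2 : ‖(2 : ℂ)⁻¹ * (1 + L y)‖ ≤ 1 := by
      simpa using norm_half_one_add_le (hLy y) le_rfl (norm_nonneg _)
    have h3 := pow_le_one₀ (n := n) (norm_nonneg _) h2
    nlinarith [norm_nonneg ((h : UnitBall X →ᵇ ℂ) y)]
  · have h1 := norm_half_one_add_le (hLy y) hδ.le hy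
    have h2 : ‖(h : UnitBall X →ᵇ ℂ) y‖ ≤ ‖h‖ := (h : UnitBall X →ᵇ ℂ).norm_coe_le_norm y
    calc _ ≤ ‖h‖ * q ^ n := by gcongr
      _ ≤ ε / 2 := (hN n hn).le

/-- Every character in the fiber over `x` is evaluation at `x`: with `g` the peak function at `x`
and `h = f - f(x)`, one has `φ h = φ (h gⁿ) → 0`. -/
theorem apply_eq_boundaryValue_of_mem_fiber {x : X} (hx : ‖x‖ = 1)
    (hconv : LocallyUniformlyConvexAt x) {φ : WeakDual.characterSpace ℂ (AInfty X)}
    (hφ : φ ∈ fiber (AInfty X) (AU_le_AInfty X) (NormedSpace.inclusionInDoubleDual ℂ X x))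
    (f : AInfty X) : φ f = boundaryValue x f := by
  obtain ⟨L, hL, hLx⟩ := exists_dual_vector'' ℂ x
  replace hLx : L x = 1 := by simpa [hx] using hLx
  let g : AInfty X :=
    (2 : ℂ)⁻¹ • (1 + Subalgebra.inclusion (AU_le_AInfty X) (dualRestrict L))
  let h : AInfty X := f - algebraMap ℂ (AInfty X) (boundaryValue x f)
  have hφg : φ g = 1 := by
    have h1 : φ (Subalgebra.inclusion (AU_le_AInfty X) (dualRestrict L)) = 1 := by
      rw [hφ L, NormedSpace.dual_def, hLx]
    rw [map_smul, map_add, map_one, h1]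
    norm_num
  have h0 : boundaryValue x h = 0 := boundaryValue_eq hx.le (by
    simpa using! (tendsto_boundaryValue hx.le f).sub_const (boundaryValue x f))
  have ht := tendsto_mul_peak_pow hx hconv hL hLx (h := h) (g := g) (fun _ => rfl) h0
  have hc : Tendsto (fun n : ℕ => φ (h * g ^ n)) atTop (𝓝 (φ 0)) :=
    ((map_continuous φ).tendsto 0).comp ht
  simp only [map_mul, map_pow, hφg, one_pow, mul_one, map_zero] at hc
  have h1 : φ h = 0 := tendsto_nhds_unique tendsto_const_nhds hc
  rw [map_sub, AlgHomClass.commutes, sub_eq_zero] at h1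
  exact h1

theorem fiber_eq_singleton {x : X} (hx : ‖x‖ = 1) (hconv : LocallyUniformlyConvexAt x) :
    fiber (AInfty X) (AU_le_AInfty X) (NormedSpace.inclusionInDoubleDual ℂ X x) =
      {evalCharacter x hx.le} := by
  refine Set.eq_singleton_iff_unique_mem.2 ⟨fun L => boundaryValue_dualRestrict hx.le L, ?_⟩
  exact fun φ hφ => DFunLike.ext _ _ (apply_eq_boundaryValue_of_mem_fiber hx hconv hφ)

theorem polyFiber_eq_singleton {x : X} (hx : ‖x‖ = 1) (hconv : LocallyUniformlyConvexAt x) :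
    polyFiber (AInfty X) (AU_le_AInfty X) (NormedSpace.inclusionInDoubleDual ℂ X x) =
      {evalCharacter x hx.le} := by
  refine Set.eq_singleton_iff_unique_mem.2
    ⟨fun g => (isAronBernerValue_inclusionInDoubleDual_iff hx.le g _).2 rfl, fun φ hφ => ?_⟩
  rw [← Set.mem_singleton_iff, ← fiber_eq_singleton hx hconv]
  intro L
  rw [(isAronBernerValue_inclusionInDoubleDual_iff hx.le _ _).1 (hφ (dualRestrict L)),
    boundaryValue_dualRestrict hx.le, NormedSpace.dual_def]

/-! ### The cluster sets are points -/

theorem clusterSet_eq_singleton {x : X} (hx : ‖x‖ = 1) (hconv : LocallyUniformlyConvexAt x)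
    (f : AInfty X) :
    clusterSet (f : UnitBall X →ᵇ ℂ) (NormedSpace.inclusionInDoubleDual ℂ X x) =
      {boundaryValue x f} := by
  refine Set.eq_singleton_iff_unique_mem.2 ⟨⟨nhdsInBall x, nhdsInBall_neBot hx.le, fun L =>
    (L.continuous.tendsto x).comp (tendsto_nhdsInBall x), tendsto_boundaryValue hx.le f⟩, ?_⟩
  rintro w ⟨l, hl, hlx, hw⟩
  exact tendsto_nhds_unique hw
    ((tendsto_boundaryValue hx.le f).mono_left (le_nhdsInBall_of_tendsto hx hconv hlx))

theorem polyClusterSet_eq_singleton {x : X} (hx : ‖x‖ = 1) (hconv : LocallyUniformlyConvexAt x)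
    (f : AInfty X) :
    polyClusterSet (f : UnitBall X →ᵇ ℂ) (NormedSpace.inclusionInDoubleDual ℂ X x) =
      {boundaryValue x f} := by
  refine Set.eq_singleton_iff_unique_mem.2 ⟨⟨nhdsInBall x, nhdsInBall_neBot hx.le, fun P => ?_,
    tendsto_boundaryValue hx.le f⟩, ?_⟩
  · rw [P.aronBerner_inclusionInDoubleDual]
    exact (P.continuous_eval.tendsto x).comp (tendsto_nhdsInBall x)
  · rintro w ⟨l, hl, hlx, hw⟩
    rw [← Set.mem_singleton_iff, ← clusterSet_eq_singleton hx hconv f]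
    refine ⟨l, hl, fun L => ?_, hw⟩
    have h := hlx (linearPolynomial L)
    simpa only [ContPolynomial.aronBerner_inclusionInDoubleDual, linearPolynomial_eval] using! h

end ClusterValue

theorem corollary4p11 {X : Type*} [NormedAddCommGroup X] [NormedSpace ℂ X] [CompleteSpace X]
    (x : X) (hx : ‖x‖ = 1) (hconv : ClusterValue.LocallyUniformlyConvexAt x) :
    ClusterValue.PolyClusterValueTheoremAt (ClusterValue.AInfty X) (ClusterValue.AU_le_AInfty X)
        (NormedSpace.inclusionInDoubleDual ℂ X x) ∧
      ClusterValue.ClusterValueTheoremAt (ClusterValue.AInfty X) (ClusterValue.AU_le_AInfty X)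
        (NormedSpace.inclusionInDoubleDual ℂ X x) := by
  constructor
  · intro f
    rw [ClusterValue.polyClusterSet_eq_singleton hx hconv,
      ClusterValue.polyFiber_eq_singleton hx hconv, Set.image_singleton]
    rfl
  · intro f
    rw [ClusterValue.clusterSet_eq_singleton hx hconv,
      ClusterValue.fiber_eq_singleton hx hconv, Set.image_singleton]
    rfl
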